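/- Let $k\ge 2$ and $d\ge 0$. For $m\ge 1$ let $(\mathbb Z_k)^{*m}$ be the $m$-fold join of the discrete set $\mathbb Z_k$, i.e. the simplicial complex on $\mathbb Z_k\times\{1,\dots,m\}$ whose simplices are the nonempty sets of vertices with at most one vertex in each copy $\mathbb Z_k\times\{j\}$; its facets are written $\langle i_1,\dots,i_m\rangle$, with $i_j\in\mathbb Z_k$ the vertex in the $j$-th copy. For $m\ge d+1$ let $(\mathbb Z_k)^{*m}_{\mathrm{alt}\le d}$ be the subcomplex of $(\mathbb Z_k)^{*m}$ generated by the facets $\langle i_1,\dots,i_m\rangle$ with at most $d$ jumps, that is, with $\#\{j : 1\le j\le m-1,\ i_j\ne i_{j+1}\}\le d$, and let $$(\mathbb Z_k)^{*\mathbb N}_{\mathrm{alt}\le d}=\bigcup_{m\ge d+1}(\mathbb Z_k)^{*m}_{\mathrm{alt}\le d}.$$ The group $\mathbb Z_k$ acts on all these complexes by shifting the elements of all copies of $\mathbb Z_k$ simultaneously. All complexes are identified with their geometric realizations, with the weak topology. Then $(\mathbb Z_k)^{*(d+1)}=(\mathbb Z_k)^{*(d+1)}_{\mathrm{alt}\le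 d}$, and all the inclusions of $\mathbb Z_k$-spaces $$(\mathbb Z_k)^{*(d+1)}=(\mathbb Z_k)^{*(d+1)}_{\mathrm{alt}\le d}\subset(\mathbb Z_k)^{*(d+2)}_{\mathrm{alt}\le d}\subset\cdots\subset(\mathbb Z_k)^{*m}_{\mathrm{alt}\le d}\subset\cdots\subset(\mathbb Z_k)^{*\mathbb N}_{\mathrm{alt}\le d}$$ are inclusions of strong deformation retracts (in the non-equivariant sense): for any two spaces $A\subset X$ of this chain, including $X=(\mathbb Z_k)^{*\mathbb N}_{\mathrm{alt}\le d}$, there is a retraction $r\colon X\to A$ such that the identity of $X$ is homotopic, relative to $A$, to $r$ followed by the inclusion $A\subset X$. -/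

import Mathlib

open Finset

/-! ### Geometric realization of an abstract simplicial complex -/

/-- A point of the geometric realization `|K|` of an abstract simplicial complex `K`, given by its
barycentric coordinates: nonnegative reals, finitely many of them nonzero, with sum `1`, such that
the vertices with nonzero coordinate span a face of `K`. -/
@[ext]
structure Realization {V : Type*} (K : PreAbstractSimplicialComplex V) where
  coord : V →₀ ℝ
  nonneg : ∀ v, 0 ≤ coord v
  sum_eq_one : (coord.sum fun _ a => a) = 1
  support_mem : coord.support ∈ K.faces

namespace Realization

variable {V : Type*}

/-- The closed geometric simplex of `|K|` spanned by a finite set `s` of vertices. -/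
structure ClosedSimplex (K : PreAbstractSimplicialComplex V) (s : Finset V) where
  pt : Realization K
  support_subset : pt.coord.support ⊆ s

/-- A closed simplex has its usual (Euclidean) topology, induced by the barycentric coordinates;
there are only finitely many coordinates that are not identically zero on it. -/
instance (K : PreAbstractSimplicialComplex V) (s : Finset V) :
    TopologicalSpace (ClosedSimplex K s) :=
  TopologicalSpace.induced (fun x : ClosedSimplex K s => (fun v => x.pt.coord v : V → ℝ))
    inferInstance

/-- The topology of `|K|` is the usual weak topology: a subset of `|K|` is open (closed) if and
only if its intersection with each closed simplex of `K` is open (closed) in that simplex. -/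
instance (K : PreAbstractSimplicialComplex V) : TopologicalSpace (Realization K) :=
  ⨆ s : K.faces, TopologicalSpace.coinduced
    (fun x : ClosedSimplex K (s : Finset V) => x.pt) inferInstance

theorem continuous_simplex (K : PreAbstractSimplicialComplex V) {s : Finset V} (hs : s ∈ K.faces) :
    Continuous (fun x : ClosedSimplex K s => x.pt) :=
  continuous_iff_coinduced_le.2
    (le_iSup (fun s : K.faces => TopologicalSpace.coinduced
      (fun x : ClosedSimplex K (s : Finset V) => x.pt) inferInstance) ⟨s, hs⟩)

theorem continuous_of_simplices {K : PreAbstractSimplicialComplex V} {Y : Type*}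
    [TopologicalSpace Y] {f : Realization K → Y}
    (hf : ∀ s ∈ K.faces, Continuous fun x : ClosedSimplex K s => f x.pt) : Continuous f :=
  continuous_iSup_dom.2 fun s => continuous_coinduced_dom.2 (hf s.1 s.2)

theorem continuous_coord {K : PreAbstractSimplicialComplex V} {s : Finset V} (v : V) :
    Continuous fun x : ClosedSimplex K s => x.pt.coord v :=
  (continuous_apply v).comp
    (continuous_induced_dom (f := fun x : ClosedSimplex K s => (fun v => x.pt.coord v : V → ℝ)))

/-- The inclusion `|L| → |K|` for a subcomplex `L` of `K`; it does not change the barycentric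
coordinates. -/
def incl {L K : PreAbstractSimplicialComplex V} (h : L ≤ K) : C(Realization L, Realization K) where
  toFun x := ⟨x.coord, x.nonneg, x.sum_eq_one, h x.support_mem⟩
  continuous_toFun := continuous_of_simplices fun s hs =>
    (continuous_simplex K (h hs)).comp
      (f := fun x : ClosedSimplex L s =>
        (⟨⟨x.pt.coord, x.pt.nonneg, x.pt.sum_eq_one, h x.pt.support_mem⟩,
          x.support_subset⟩ : ClosedSimplex K s))
      (continuous_induced_rng.2 (continuous_pi fun v => continuous_coord v))

end Realization

/-- The map `i : A → X` is the inclusion of a strong deformation retract: there is a retraction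
`r : X → A` such that the identity of `X` is homotopic to `i ∘ r` by a homotopy that is constant on
(the image of) `A`. (As `r ∘ i = id`, the map `i` is automatically an embedding.) -/
def IsStrongDeformationRetract {A X : Type*} [TopologicalSpace A] [TopologicalSpace X]
    (i : C(A, X)) : Prop :=
  ∃ r : C(X, A), r.comp i = ContinuousMap.id A ∧
    (ContinuousMap.id X).HomotopicRel (i.comp r) (Set.range i)

/-! ### The complexes

All complexes have their vertices in `ZMod k × ℕ`; the vertex `(i, j)` is the element `i` of the
copy of `ℤ_k` with number `j` (the copies are numbered from `0`). -/

/-- The join `(ℤ_k)^{*m}` of `m` copies of the discrete set `ℤ_k`: its simplices are the nonempty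
finite sets of vertices that lie in the first `m` copies and have at most one element in each
copy. -/
def joinComplex (k m : ℕ) : PreAbstractSimplicialComplex (ZMod k × ℕ) where
  faces := {s | s.Nonempty ∧ (∀ v ∈ s, v.2 < m) ∧ ∀ v ∈ s, ∀ w ∈ s, v.2 = w.2 → v = w}
  isRelLowerSet_faces := fun _ hs => ⟨hs.1, fun _ hts ht =>
    ⟨ht, fun v hv => hs.2.1 v (hts hv), fun v hv w hw => hs.2.2 v (hts hv) w (hts hw)⟩⟩

/-- The number of jumps of the sequence `i 0, …, i (m - 1)`: the number of positions at which two
consecutive members of this sequence differ. -/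
def numJumps {k : ℕ} (m : ℕ) (i : ℕ → ZMod k) : ℕ :=
  #{j ∈ range m | j + 1 < m ∧ i j ≠ i (j + 1)}

/-- The simplex `⟨i 0, …, i (m - 1)⟩` of `(ℤ_k)^{*m}`, with one vertex in each copy. -/
def fullSimplex {k : ℕ} (m : ℕ) (i : ℕ → ZMod k) : Finset (ZMod k × ℕ) :=
  (range m).image fun j => (i j, j)

/-- The complex `(ℤ_k)^{*m}_{alt ≤ d}`, generated by the simplices `⟨i 0, …, i (m - 1)⟩` of
`(ℤ_k)^{*m}` with at most `d` jumps. -/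
def altComplex (k d m : ℕ) : PreAbstractSimplicialComplex (ZMod k × ℕ) where
  faces := {s | s.Nonempty ∧ ∃ i : ℕ → ZMod k, numJumps m i ≤ d ∧ s ⊆ fullSimplex m i}
  isRelLowerSet_faces := fun _ hs => ⟨hs.1, fun _ hts ht =>
    ⟨ht, hs.2.imp fun _ hi => ⟨hi.1, hts.trans hi.2⟩⟩⟩

/-- The complex `(ℤ_k)^{*ℕ}_{alt ≤ d}`, the union of all `(ℤ_k)^{*m}_{alt ≤ d}` with
`m ≥ d + 1`. -/
def altComplexUnion (k d : ℕ) : PreAbstractSimplicialComplex (ZMod k × ℕ) where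
  faces := ⋃ m ≥ d + 1, (altComplex k d m).faces
  isRelLowerSet_faces := IsRelLowerSet.iUnion₂ fun m _ => (altComplex k d m).isRelLowerSet_faces

/-! ### The action of `ℤ_k` -/

/-- The action of `g ∈ ℤ_k` on the vertices: it shifts the sign of each vertex and keeps its
copy. -/
def shift {k : ℕ} (g : ZMod k) : (ZMod k × ℕ) ≃ (ZMod k × ℕ) where
  toFun v := (g + v.1, v.2)
  invFun v := (-g + v.1, v.2)
  left_inv v := by simp
  right_inv v := by simp

/-- The complex `K` is invariant under the action of `ℤ_k`. -/
class ShiftInvariant {k : ℕ} (K : PreAbstractSimplicialComplex (ZMod k × ℕ)) : Prop where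
  map_mem : ∀ (g : ZMod k), ∀ s ∈ K.faces, s.map (shift g).toEmbedding ∈ K.faces

theorem altComplex_map_mem {k d m : ℕ} (g : ZMod k) (s : Finset (ZMod k × ℕ))
    (hs : s ∈ (altComplex k d m).faces) :
    s.map (shift g).toEmbedding ∈ (altComplex k d m).faces := by
  obtain ⟨hne, i, hi, hsi⟩ := hs
  refine ⟨hne.map, fun j => g + i j, ?_, ?_⟩
  · simpa [numJumps] using hi
  · intro v hv
    obtain ⟨w, hw, rfl⟩ := Finset.mem_map.1 hv
    obtain ⟨j, hj, rfl⟩ := Finset.mem_image.1 (hsi hw)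
    exact Finset.mem_image.2 ⟨j, hj, rfl⟩

instance (k d m : ℕ) : ShiftInvariant (altComplex k d m) where
  map_mem := altComplex_map_mem

instance (k d : ℕ) : ShiftInvariant (altComplexUnion k d) where
  map_mem g s hs := by
    simp only [altComplexUnion, Set.mem_iUnion] at hs ⊢
    obtain ⟨m, hm, h⟩ := hs
    exact ⟨m, hm, altComplex_map_mem g s h⟩

namespace Realization

variable {k : ℕ} {K : PreAbstractSimplicialComplex (ZMod k × ℕ)} [ShiftInvariant K]

/-- `ℤ_k` acts on the realization of an invariant complex through its action on the vertices: the
coordinate of `x` at the vertex `v` is the coordinate of `g +ᵥ x` at `shift g v`. -/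
instance : VAdd (ZMod k) (Realization K) where
  vadd g x :=
    { coord := x.coord.equivMapDomain (shift g)
      nonneg := fun v => x.nonneg _
      sum_eq_one := by
        rw [← x.sum_eq_one, Finsupp.equivMapDomain_eq_mapDomain]
        exact Finsupp.sum_mapDomain_index (fun _ => rfl) (fun _ _ _ => rfl)
      support_mem := ShiftInvariant.map_mem g _ x.support_mem }

theorem vadd_coord (g : ZMod k) (x : Realization K) (v : ZMod k × ℕ) :
    (g +ᵥ x).coord v = x.coord ((shift g).symm v) := rfl

instance : AddAction (ZMod k) (Realization K) where
  zero_vadd x := by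
    ext v
    rw [vadd_coord]
    simp [shift]
  add_vadd g h x := by
    ext v
    simp only [vadd_coord]
    simp [shift, add_assoc]

instance : ContinuousConstVAdd (ZMod k) (Realization K) where
  continuous_const_vadd g := continuous_of_simplices fun s hs =>
    (continuous_simplex K (ShiftInvariant.map_mem g s hs)).comp
      (f := fun x : ClosedSimplex K s =>
        (⟨g +ᵥ x.pt, Finset.map_subset_map.2 x.support_subset⟩ :
          ClosedSimplex K (s.map (shift g).toEmbedding)))
      (continuous_induced_rng.2 (continuous_pi fun v => continuous_coord ((shift g).symm v)))

end Realization

/-! ### Composition of strong deformation retracts -/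

open scoped unitInterval

/-! Passing from `m` to `m + 1` copies is a sequence of collapses. Let `tailComplex k d m j` consist
of the simplices on `m + 1` copies that do not contain vertices in all copies `j, …, m` with every
two consecutive signs different. For `j = 0` this is the whole complex, since such a simplex would
need `m > d` jumps; for `j = m` it says that copy `m` is unused, which gives the complex on `m`
copies.

A simplex present at `j` but not at `j + 1` jumps throughout `j + 1, …, m`. It can be enlarged by
the vertex of copy `j` whose sign is that of copy `j + 1`, at no cost in jumps
(`exists_full_of_notMem`). Hence its part after copy `j` is a free face: mass slides from there to
the new vertex until a coordinate of that part vanishes and the tail is broken (`tailCollapse`).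
`Collapse.isStrongDeformationRetract` turns this into a homotopy, and finitely many of these
compose.

For the union, the infinitely many deformations are fitted into `[0, 1]` with the later stages
performed first (`isStrongDeformationRetract_union`). The weak topology makes the result continuous,
because each simplex lies in a finite stage and is at rest for all small times. -/

/-- Strong deformation retracts compose. -/
theorem IsStrongDeformationRetract.comp {A B X : Type*} [TopologicalSpace A] [TopologicalSpace B]
    [TopologicalSpace X] {j : C(B, X)} {i : C(A, B)} (hj : IsStrongDeformationRetract j)
    (hi : IsStrongDeformationRetract i) : IsStrongDeformationRetract (j.comp i) := by
  obtain ⟨r, hr, ⟨H⟩⟩ := hj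
  obtain ⟨q, hq, ⟨G⟩⟩ := hi
  have hr' : ∀ b, r (j b) = b := fun b => DFunLike.congr_fun hr b
  have hq' : ∀ a, q (i a) = a := fun a => DFunLike.congr_fun hq a
  refine ⟨q.comp r, by ext a; simp [hr', hq'], ?_⟩
  have h1 : (ContinuousMap.id X).HomotopicRel (j.comp r) (Set.range (j.comp i)) :=
    ⟨⟨H.toHomotopy, fun t x hx => H.prop' t x (by
      obtain ⟨a, rfl⟩ := hx
      exact ⟨i a, rfl⟩)⟩⟩
  -- After `X` has been pushed to `B`, the second homotopy deforms `r x` inside `B` by `G`.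
  refine h1.trans ⟨⟨⟨⟨fun p => j (G (p.1, r p.2)), by fun_prop⟩, fun x => ?_, fun x => ?_⟩, ?_⟩⟩
  · simp
  · simp
  · rintro t _ ⟨a, rfl⟩
    have := G.eq_fst t (x := i a) ⟨a, rfl⟩
    simp [hr', this]

theorem isStrongDeformationRetract_id (X : Type*) [TopologicalSpace X] :
    IsStrongDeformationRetract (ContinuousMap.id X) :=
  ⟨ContinuousMap.id X, by ext; rfl, ContinuousMap.HomotopicRel.refl _⟩

/-! ### Continuity in the weak topology -/

namespace Realization

variable {V : Type*}

/-- A point of `|K|` whose support is a face of `L`, as a point of `|L|`. -/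
def codRestrict {K : PreAbstractSimplicialComplex V} (L : PreAbstractSimplicialComplex V)
    (x : Realization K) (h : x.coord.support ∈ L.faces) : Realization L :=
  ⟨x.coord, x.nonneg, x.sum_eq_one, h⟩

theorem support_nonempty {K : PreAbstractSimplicialComplex V} (x : Realization K) :
    x.coord.support.Nonempty :=
  (K.isRelLowerSet_faces x.support_mem).1

theorem support_mem_of_mem {K L : PreAbstractSimplicialComplex V} {s : Finset V}
    (hs : s ∈ L.faces) (x : ClosedSimplex K s) : x.pt.coord.support ∈ L.faces :=
  (L.isRelLowerSet_faces hs).2 x.support_subset x.pt.support_nonempty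

/-- A map into a realization is continuous as soon as it takes values in one closed simplex and
its coordinates are continuous. -/
theorem continuous_of_coord {K : PreAbstractSimplicialComplex V} {s : Finset V} (hs : s ∈ K.faces)
    {Y : Type*} [TopologicalSpace Y] {f : Y → Realization K}
    (hsub : ∀ y, (f y).coord.support ⊆ s) (hf : ∀ v, Continuous fun y => (f y).coord v) :
    Continuous f :=
  (continuous_simplex K hs).comp (f := fun y => (⟨f y, hsub y⟩ : ClosedSimplex K s))
    (continuous_induced_rng.2 (continuous_pi hf))

/-- Continuity of a map on `|K| × T` for locally compact `T` can be checked on the products of the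
closed simplices with `T`. -/
theorem continuous_prod_of_simplices {K : PreAbstractSimplicialComplex V} {T Y : Type*}
    [TopologicalSpace T] [LocallyCompactSpace T] [TopologicalSpace Y] {f : Realization K × T → Y}
    (hf : ∀ s ∈ K.faces, Continuous fun p : ClosedSimplex K s × T => f (p.1.pt, p.2))
    (hT : ∀ x, Continuous fun t => f (x, t)) : Continuous f := by
  -- Currying leaves a map on `|K|` alone, where continuity is tested on simplices; local
  -- compactness of `T` allows uncurrying.
  let F : Realization K → C(T, Y) := fun x => ⟨fun t => f (x, t), hT x⟩
  have hF : Continuous F := continuous_of_simplices fun s hs =>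
    (ContinuousMap.curry ⟨_, hf s hs⟩).continuous
  exact (ContinuousMap.uncurry ⟨F, hF⟩).continuous

/-! ### Infinite composition over an increasing union -/

section Union

variable {K : ℕ → PreAbstractSimplicialComplex V} {U : PreAbstractSimplicialComplex V}
  (hK : ∀ n, K n ≤ K (n + 1)) (hU : ∀ n, K n ≤ U)

/-- Compatible continuous maps on an increasing sequence of complexes glue to a continuous map on
the union. -/
theorem exists_glue (hcov : ∀ s ∈ U.faces, ∃ n, s ∈ (K n).faces) {Y : Type*} [TopologicalSpace Y]
    (f : ∀ n, C(Realization (K n), Y)) (hf : ∀ n x, f (n + 1) (incl (hK n) x) = f n x) :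
    ∃ F : C(Realization U, Y), ∀ n x, F (incl (hU n) x) = f n x := by
  have hmono : Monotone K := monotone_nat_of_le_succ hK
  have hf' : ∀ {m n} (h : m ≤ n) (x : Realization (K m)), f n (incl (hmono h) x) = f m x := by
    intro m n h
    induction n, h using Nat.le_induction with
    | base => exact fun x => rfl
    | succ n h ih => exact fun x => (hf n (incl (hmono h) x)).trans (ih x)
  choose N hN using fun x : Realization U => hcov _ x.support_mem
  -- The value does not depend on the chosen stage: two stages are compared in their maximum.
  have key : ∀ x n (h : x.coord.support ∈ (K n).faces),
      f (N x) (codRestrict _ x (hN x)) = f n (codRestrict _ x h) := fun x n h =>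
    (hf' (le_max_left (N x) n) _).symm.trans (hf' (le_max_right (N x) n) (codRestrict _ x h))
  refine ⟨⟨fun x => f (N x) (codRestrict _ x (hN x)), continuous_of_simplices fun s hs => ?_⟩,
    fun n x => key (incl (hU n) x) n x.support_mem⟩
  obtain ⟨n, hn⟩ := hcov s hs
  have : (fun x : ClosedSimplex U s => f (N x.pt) (codRestrict _ x.pt (hN x.pt))) =
      fun x => f n (codRestrict _ x.pt (support_mem_of_mem hn x)) :=
    funext fun x => key x.pt n (support_mem_of_mem hn x)
  rw [this]
  exact (f n).continuous.comp
    (continuous_of_coord hn (fun x => x.support_subset) fun v => continuous_coord v)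

/-- If each complex of an increasing sequence is a strong deformation retract of the next one,
then the first one is a strong deformation retract of the union: the `n`-th deformation is
performed in the time interval `[1 / (n + 2), 1 / (n + 1)]`. -/
theorem isStrongDeformationRetract_union (hcov : ∀ s ∈ U.faces, ∃ n, s ∈ (K n).faces)
    (hsdr : ∀ n, IsStrongDeformationRetract (incl (hK n))) :
    IsStrongDeformationRetract (incl (hU 0)) := by
  choose r hr hH using hsdr
  have hr' : ∀ n x, r n (incl (hK n) x) = x := fun n x => DFunLike.congr_fun (hr n) x
  have h := fun n => (hH n).some
  let c : ℕ → ℝ := fun n => 1 / (n + 1)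
  have hc : ∀ n, c (n + 1) < c n := fun n => by
    simp only [c]
    push_cast
    exact one_div_lt_one_div_of_lt (by positivity) (by linarith)
  have hc0 : ∀ n, 0 < c n := fun n => by positivity
  let ρ : ∀ n, C(Realization (K n), Realization (K 0)) := fun n =>
    Nat.rec (motive := fun n => C(Realization (K n), Realization (K 0))) (ContinuousMap.id _)
      (fun n f => f.comp (r n)) n
  obtain ⟨R, hR⟩ := exists_glue hK hU hcov ρ fun n x => congrArg (ρ n) (hr' n x)
  -- Homotopies on stage `n` that rest until time `c n`, which is when the deformations of stages
  -- beyond `n` are over.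
  let P := fun n => {G : C(Realization (K n) × ℝ, Realization U) //
    ∀ x t, t ≤ c n → G (x, t) = incl (hU n) x}
  let τ : ℕ → ℝ → I := fun n t => Set.projIcc 0 1 zero_le_one ((t - c (n + 1)) / (c n - c (n + 1)))
  have hτ1 : ∀ n, τ n (c n) = 1 := fun n => by
    simp only [τ, div_self (sub_pos.2 (hc n)).ne']
    exact Set.projIcc_right _
  -- On stage `n + 1`, the deformation to stage `n` runs until `c n`; afterwards the retracted point
  -- follows `G`. Both branches agree at `c n` because `G` still rests there.
  have step : ∀ n (G : P n), ∃ G' : P (n + 1), ∀ x t, G'.1 (x, t) =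
      if t ≤ c n then incl (hU (n + 1)) (h n (τ n t, x)) else G.1 (r n x, t) := by
    rintro n ⟨G, hG⟩
    have hcn := sub_pos.2 (hc n)
    refine ⟨⟨⟨fun p => if p.2 ≤ c n then incl (hU (n + 1)) (h n (τ n p.2, p.1))
      else G (r n p.1, p.2), ?_⟩, ?_⟩, fun x t => rfl⟩
    · have : Continuous (τ n) := continuous_projIcc.comp (by fun_prop)
      refine Continuous.if_le (by fun_prop) (by fun_prop) (by fun_prop) (by fun_prop) ?_
      rintro ⟨x, t⟩ (rfl : t = c n)
      rw [hG _ _ le_rfl, hτ1, (h n).apply_one]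
      rfl
    · intro x t ht
      have hτ : τ n t = 0 :=
        Set.projIcc_of_le_left _ (div_nonpos_of_nonpos_of_nonneg (sub_nonpos.2 ht) hcn.le)
      simp only [ContinuousMap.coe_mk]
      rw [if_pos (ht.trans (hc n).le), hτ, (h n).apply_zero]
      rfl
  choose next hnext using step
  let G : ∀ n, P n := fun n => Nat.rec (motive := P)
    ⟨⟨fun p => incl (hU 0) p.1, by fun_prop⟩, fun _ _ _ => rfl⟩ next n
  have hG : ∀ n x t, (G (n + 1)).1 (x, t) =
      if t ≤ c n then incl (hU (n + 1)) (h n (τ n t, x)) else (G n).1 (r n x, t) :=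
    fun n => hnext n (G n)
  obtain ⟨F, hF⟩ := exists_glue hK hU hcov (fun n => (G n).1.curry) fun n x => by
    ext1 t
    simp only [ContinuousMap.curry_apply]
    rw [hG]
    split_ifs with ht
    · rw [(G n).2 _ _ ht, (h n).eq_fst _ ⟨x, rfl⟩]
      rfl
    · rw [hr']
  have hF' : ∀ n x t, F (incl (hU n) x) t = (G n).1 (x, t) := fun n x t => by rw [hF]; rfl
  have hex : ∀ y : Realization U, ∃ n x, y = incl (hU n) x := fun y => by
    obtain ⟨n, hn⟩ := hcov _ y.support_mem
    exact ⟨n, codRestrict _ y hn, rfl⟩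
  refine ⟨R, by ext1 x; exact hR 0 x,
    ⟨⟨⟨⟨fun p => F p.2 p.1, ?_⟩, fun y => ?_, fun y => ?_⟩, ?_⟩⟩⟩
  · exact (ContinuousMap.uncurry F).continuous.comp (f := fun p : I × _ => (p.2, (p.1 : ℝ)))
      (by fun_prop)
  · obtain ⟨n, x, rfl⟩ := hex y
    exact (hF' n x 0).trans ((G n).2 _ _ (hc0 n).le)
  · obtain ⟨n, x, rfl⟩ := hex y
    refine (hF' n x 1).trans ?_
    simp only [ContinuousMap.comp_apply, hR]
    induction n with
    | zero => rfl
    | succ n ih =>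
      rw [hG]
      split_ifs with h1
      -- Time `1` is at most `c n` only for `n = 0`.
      · obtain rfl : n = 0 := by
          by_contra hn
          have : (0 : ℝ) < n := by exact_mod_cast Nat.pos_of_ne_zero hn
          have : c n < 1 := (div_lt_one (by positivity)).2 (by linarith)
          linarith
        have hc1 : (1 : ℝ) = c 0 := by simp [c]
        rw [(congrArg (τ 0) hc1).trans (hτ1 0), (h 0).apply_one]
        rfl
      · exact ih (r n x)
  · rintro t _ ⟨x, rfl⟩
    exact hF' 0 x t

end Union

end Realization

/-! ### Sliding mass from a set of vertices to one vertex -/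

namespace Realization

variable {V : Type*}

/-- The least of the values `c a` for `a ∈ τ`, and `0` if `τ` is empty. -/
noncomputable def minOn (τ : Finset V) (c : V → ℝ) : ℝ :=
  if h : τ.Nonempty then τ.inf' h c else 0

theorem minOn_nonneg {τ : Finset V} {c : V → ℝ} (hc : ∀ v, 0 ≤ c v) : 0 ≤ minOn τ c := by
  unfold minOn
  split_ifs
  · exact Finset.le_inf' _ _ fun v _ => hc v
  · exact le_rfl

theorem minOn_le {τ : Finset V} {c : V → ℝ} {a : V} (ha : a ∈ τ) : minOn τ c ≤ c a := by
  rw [minOn, dif_pos ⟨a, ha⟩]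
  exact Finset.inf'_le _ ha

theorem exists_eq_minOn {τ : Finset V} (h : τ.Nonempty) (c : V → ℝ) :
    ∃ a ∈ τ, c a = minOn τ c := by
  obtain ⟨a, ha, h'⟩ := Finset.exists_mem_eq_inf' h c
  exact ⟨a, ha, by rw [minOn, dif_pos h, h']⟩

theorem continuous_minOn {Y : Type*} [TopologicalSpace Y] (τ : Finset V) {c : Y → V → ℝ}
    (hc : ∀ v, Continuous fun y => c y v) : Continuous fun y => minOn τ (c y) := by
  unfold minOn
  split_ifs with h
  · exact Continuous.finset_inf'_apply h fun v _ => hc v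
  · exact continuous_const

/-- Move the fraction `t` of the mass that the coordinates in `τ` have in common to the
vertex `v`. -/
noncomputable def slide (τ : Finset V) (v : V) (t : ℝ) (c : V →₀ ℝ) : V →₀ ℝ :=
  c + (t * minOn τ c) • (Finsupp.single v (#τ : ℝ) - ∑ a ∈ τ, Finsupp.single a 1)

theorem slide_zero (τ : Finset V) (v : V) (c : V →₀ ℝ) : slide τ v 0 c = c := by simp [slide]

/-- A vertex of `τ` outside the support makes the common mass zero. This is what keeps the
subcomplex fixed during a collapse. -/
theorem slide_of_not_subset {τ : Finset V} (v : V) (t : ℝ) {c : V →₀ ℝ} (hc : ∀ v, 0 ≤ c v)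
    (h : ¬ τ ⊆ c.support) : slide τ v t c = c := by
  obtain ⟨a, ha, ha'⟩ := Finset.not_subset.1 h
  have h0 : minOn τ c = 0 :=
    le_antisymm ((minOn_le ha).trans (Finsupp.notMem_support_iff.1 ha').le) (minOn_nonneg hc)
  simp [slide, h0]

theorem sum_slide (τ : Finset V) (v : V) (t : ℝ) (c : V →₀ ℝ) :
    ((slide τ v t c).sum fun _ a => a) = c.sum fun _ a => a := by
  have h : ∀ c : V →₀ ℝ, (c.sum fun _ a => a) = Finsupp.linearCombination ℝ (fun _ => (1 : ℝ)) c :=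
    fun c => by simp [Finsupp.linearCombination_apply]
  rw [h, h, slide]
  simp

theorem support_nonempty_of_sum {c : V →₀ ℝ} (h : (c.sum fun _ a => a) = 1) :
    c.support.Nonempty := by
  rw [Finset.nonempty_iff_ne_empty, Ne, Finsupp.support_eq_empty]
  rintro rfl
  simp at h

variable [DecidableEq V]

theorem slide_apply (τ : Finset V) (v : V) (t : ℝ) (c : V →₀ ℝ) (w : V) :
    slide τ v t c w =
      c w + t * minOn τ c * ((if v = w then (#τ : ℝ) else 0) - if w ∈ τ then 1 else 0) := by
  simp [slide, Finsupp.single_apply]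

theorem slide_nonneg {τ : Finset V} (v : V) {t : ℝ} (ht : t ∈ I) {c : V →₀ ℝ}
    (hc : ∀ v, 0 ≤ c v) (w : V) : 0 ≤ slide τ v t c w := by
  rw [slide_apply]
  have h0 := minOn_nonneg (τ := τ) hc
  -- A coordinate in `τ` loses at most the minimum over `τ`, and no other coordinate decreases.
  have h1 : t * minOn τ c ≤ minOn τ c := mul_le_of_le_one_left h0 ht.2
  have h2 : 0 ≤ t * minOn τ c * if v = w then (#τ : ℝ) else 0 :=
    mul_nonneg (mul_nonneg ht.1 h0) (by positivity)
  rw [mul_sub]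
  split_ifs at h2 ⊢ with _ hw hw
  all_goals first
    | linarith [minOn_le (c := c) hw, hc w]
    | linarith [hc w]

theorem support_slide_subset {τ s : Finset V} (v : V) (t : ℝ) {c : V →₀ ℝ} (hτ : τ ⊆ s)
    (hc : c.support ⊆ s) : (slide τ v t c).support ⊆ insert v s := by
  intro w hw
  by_contra h
  rw [Finset.mem_insert, not_or] at h
  have : c w = 0 := Finsupp.notMem_support_iff.1 fun h' => h.2 (hc h')
  rw [Finsupp.mem_support_iff, slide_apply, if_neg (Ne.symm h.1),
    if_neg fun h' => h.2 (hτ h')] at hw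
  simp [this] at hw

/-- At time `1` a vertex attaining the minimum loses its entire coordinate; it gains nothing back,
as `v ∉ τ`. -/
theorem support_slide_one_subset {τ s : Finset V} {v : V} {c : V →₀ ℝ} (hτ : τ ⊆ s)
    (hc : c.support ⊆ s) (hv : v ∉ τ) {a : V} (ha : a ∈ τ) (hmin : c a = minOn τ c) :
    (slide τ v 1 c).support ⊆ (insert v s).erase a := by
  refine Finset.subset_erase.2 ⟨support_slide_subset v 1 hτ hc, ?_⟩
  rw [Finsupp.notMem_support_iff, slide_apply, if_neg (by rintro rfl; exact hv ha), if_pos ha]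
  linarith

/-! ### Collapses give strong deformation retracts -/

/-- A collection of simultaneous collapses of a complex `K` onto a subcomplex `L`: the
faces of `K` that are not in `L` are collapsed by pushing in from their free faces `τ s` towards
the vertices `v s`. -/
structure Collapse (K L : PreAbstractSimplicialComplex V) where
  τ : Finset V → Finset V
  v : Finset V → V
  nonempty : ∀ s ∈ K.faces, s ∉ L.faces → (τ s).Nonempty
  subset : ∀ s ∈ K.faces, s ∉ L.faces → τ s ⊆ s
  v_notMem : ∀ s ∈ K.faces, s ∉ L.faces → v s ∉ τ s
  notMem : ∀ s ∈ K.faces, s ∉ L.faces → τ s ∉ L.faces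
  insert_mem : ∀ s ∈ K.faces, s ∉ L.faces → insert (v s) s ∈ K.faces
  erase_mem : ∀ s ∈ K.faces, s ∉ L.faces → ∀ a ∈ τ s, (insert (v s) s).erase a ∈ L.faces
  τ_eq : ∀ s ∈ K.faces, ∀ t ∈ K.faces, t ∉ L.faces → t ⊆ s → τ t = τ s
  v_eq : ∀ s ∈ K.faces, ∀ t ∈ K.faces, t ∉ L.faces → t ⊆ s → v t = v s

namespace Collapse

variable {K L : PreAbstractSimplicialComplex V} (C : Collapse K L)

open Classical in
/-- The coordinates at time `t` of the point that starts at `x`. -/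
noncomputable def flow (x : Realization K) (t : ℝ) : V →₀ ℝ :=
  if x.coord.support ∈ L.faces then x.coord
  else slide (C.τ x.coord.support) (C.v x.coord.support) t x.coord

theorem flow_of_mem {x : Realization K} (h : x.coord.support ∈ L.faces) (t : ℝ) :
    C.flow x t = x.coord := if_pos h

/-- One formula governs the whole closed simplex `s`, whichever branch defines the flow. If the
support of `x` lies in `L`, it cannot contain `τ s ∉ L`, so the slide is stationary; otherwise its
data agree with those of `s`. -/
theorem flow_eq_slide {s : Finset V} (hs : s ∈ K.faces) (hsL : s ∉ L.faces) {x : Realization K}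
    (hx : x.coord.support ⊆ s) (t : ℝ) : C.flow x t = slide (C.τ s) (C.v s) t x.coord := by
  by_cases h : x.coord.support ∈ L.faces
  · rw [C.flow_of_mem h, slide_of_not_subset _ _ x.nonneg]
    exact fun h' => C.notMem s hs hsL ((L.isRelLowerSet_faces h).2 h' (C.nonempty s hs hsL))
  · rw [flow, if_neg h, C.τ_eq s hs _ x.support_mem h hx, C.v_eq s hs _ x.support_mem h hx]

theorem flow_zero (x : Realization K) : C.flow x 0 = x.coord := by
  by_cases h : x.coord.support ∈ L.faces
  · exact C.flow_of_mem h 0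
  · rw [C.flow_eq_slide x.support_mem h Subset.rfl, slide_zero]

theorem flow_nonneg (x : Realization K) {t : ℝ} (ht : t ∈ I) (w : V) : 0 ≤ C.flow x t w := by
  unfold flow
  split_ifs
  · exact x.nonneg w
  · exact slide_nonneg _ ht x.nonneg w

theorem sum_flow (x : Realization K) (t : ℝ) : ((C.flow x t).sum fun _ a => a) = 1 := by
  rw [← x.sum_eq_one]
  unfold flow
  split_ifs
  · rfl
  · exact sum_slide ..

theorem flow_support_mem (x : Realization K) (t : ℝ) : (C.flow x t).support ∈ K.faces := by
  by_cases h : x.coord.support ∈ L.faces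
  · rw [C.flow_of_mem h]
    exact x.support_mem
  · refine (K.isRelLowerSet_faces (C.insert_mem _ x.support_mem h)).2 ?_
      (support_nonempty_of_sum (C.sum_flow x t))
    rw [C.flow_eq_slide x.support_mem h Subset.rfl]
    exact support_slide_subset _ _ (C.subset _ x.support_mem h) Subset.rfl

theorem flow_one_support_mem (x : Realization K) : (C.flow x 1).support ∈ L.faces := by
  by_cases h : x.coord.support ∈ L.faces
  · rwa [C.flow_of_mem h]
  · have hs := x.support_mem
    obtain ⟨a, ha, hmin⟩ := exists_eq_minOn (C.nonempty _ hs h) x.coord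
    refine (L.isRelLowerSet_faces (C.erase_mem _ hs h a ha)).2 ?_
      (support_nonempty_of_sum (C.sum_flow x 1))
    rw [C.flow_eq_slide hs h Subset.rfl]
    exact support_slide_one_subset (C.subset _ hs h) Subset.rfl (C.v_notMem _ hs h) ha hmin

/-- The retraction of `|K|` onto `|L|` given by a collapse. -/
noncomputable def retraction (x : Realization K) : Realization L :=
  ⟨C.flow x 1, C.flow_nonneg x ⟨zero_le_one, le_rfl⟩, C.sum_flow x 1, C.flow_one_support_mem x⟩

/-- The homotopy from the identity of `|K|` to the retraction onto `|L|`. -/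
noncomputable def homotopy (p : Realization K × I) : Realization K :=
  ⟨C.flow p.1 p.2, C.flow_nonneg p.1 p.2.2, C.sum_flow p.1 p.2, C.flow_support_mem p.1 p.2⟩

theorem continuous_slide {Y : Type*} [TopologicalSpace Y] (τ : Finset V) (v : V) {t : Y → ℝ}
    (ht : Continuous t) {c : Y → V →₀ ℝ} (hc : ∀ w, Continuous fun y => c y w) (w : V) :
    Continuous fun y => slide τ v (t y) (c y) w := by
  have := continuous_minOn τ (c := fun y => c y) hc
  have := hc w
  simp only [slide_apply]
  fun_prop

theorem continuous_retraction : Continuous C.retraction := by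
  refine continuous_of_simplices fun s hs => ?_
  by_cases hsL : s ∈ L.faces
  · have hflow : ∀ x : ClosedSimplex K s, C.flow x.pt 1 = x.pt.coord :=
      fun x => C.flow_of_mem (support_mem_of_mem hsL x) 1
    refine continuous_of_coord hsL (fun x => ?_) fun v => ?_
    · exact (congrArg Finsupp.support (hflow x)).trans_subset x.support_subset
    · simpa only [retraction, hflow] using continuous_coord v
  · have hflow : ∀ x : ClosedSimplex K s, C.flow x.pt 1 = slide (C.τ s) (C.v s) 1 x.pt.coord :=
      fun x => C.flow_eq_slide hs hsL x.support_subset 1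
    have hmin := continuous_minOn (C.τ s) (c := fun x : ClosedSimplex K s => x.pt.coord)
      continuous_coord
    -- The image of a simplex need not lie in a single face of `L`. The simplex is covered by
    -- finitely many closed sets, one for each vertex `a` at which the minimum may be attained; each
    -- of them is mapped into one face.
    refine (locallyFinite_of_finite fun a : C.τ s =>
      {x : ClosedSimplex K s | x.pt.coord a = minOn (C.τ s) x.pt.coord}).continuous
      (Set.eq_univ_of_forall fun x => ?_) (fun a => isClosed_eq (continuous_coord _) hmin)
      fun a => continuousOn_iff_continuous_domRestrict.2 ?_
    · obtain ⟨a, ha, h⟩ := exists_eq_minOn (C.nonempty s hs hsL) x.pt.coord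
      exact Set.mem_iUnion.2 ⟨⟨a, ha⟩, h⟩
    · refine continuous_of_coord (C.erase_mem s hs hsL a a.2) (fun x => ?_) fun v => ?_
      · exact (congrArg Finsupp.support (hflow x)).trans_subset (support_slide_one_subset
          (C.subset s hs hsL) x.1.support_subset (C.v_notMem s hs hsL) a.2 x.2)
      · simp only [Set.domRestrict_apply, retraction, hflow]
        exact continuous_slide _ _ continuous_const
          (fun w => (continuous_coord w).comp continuous_subtype_val) v

theorem continuous_homotopy_of_simplices {s : Finset V} (hs : s ∈ K.faces) {Y : Type*}
    [TopologicalSpace Y] {f : Y → ClosedSimplex K s} (hf : Continuous f) {t : Y → I}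
    (ht : Continuous t) : Continuous fun y => C.homotopy ((f y).pt, t y) := by
  by_cases hsL : s ∈ L.faces
  · have hflow : ∀ y, C.flow (f y).pt (t y) = (f y).pt.coord :=
      fun y => C.flow_of_mem (support_mem_of_mem hsL _) _
    refine continuous_of_coord hs (fun y => ?_) fun v => ?_
    · exact (congrArg Finsupp.support (hflow y)).trans_subset (f y).support_subset
    · simp only [homotopy, hflow]
      exact (continuous_coord v).comp hf
  · have hflow : ∀ y, C.flow (f y).pt (t y) = slide (C.τ s) (C.v s) (t y) (f y).pt.coord :=
      fun y => C.flow_eq_slide hs hsL (f y).support_subset _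
    refine continuous_of_coord (C.insert_mem s hs hsL) (fun y => ?_) fun v => ?_
    · exact (congrArg Finsupp.support (hflow y)).trans_subset
        (support_slide_subset _ _ (C.subset s hs hsL) (f y).support_subset)
    · simp only [homotopy, hflow]
      exact continuous_slide _ _ (continuous_subtype_val.comp ht)
        (fun w => (continuous_coord w).comp hf) v

theorem continuous_homotopy : Continuous C.homotopy :=
  continuous_prod_of_simplices
    (fun _ hs => C.continuous_homotopy_of_simplices hs continuous_fst continuous_snd)
    fun x => C.continuous_homotopy_of_simplices x.support_mem
      (f := fun _ => ⟨x, Subset.rfl⟩) continuous_const continuous_id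

/-- If `K` collapses to `L`, then `|L|` is a strong deformation retract of `|K|`. -/
theorem isStrongDeformationRetract (C : Collapse K L) (h : L ≤ K) : IsStrongDeformationRetract (incl h) := by
  have hflow : ∀ (y : Realization L) t, C.flow (incl h y) t = y.coord :=
    fun y t => C.flow_of_mem y.support_mem t
  refine ⟨⟨C.retraction, C.continuous_retraction⟩, ?_, ⟨⟨⟨⟨fun p => C.homotopy (p.2, p.1),
    C.continuous_homotopy.comp continuous_swap⟩, fun x => ?_, fun x => ?_⟩, ?_⟩⟩⟩
  · ext1 y
    exact Realization.ext (hflow y 1)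
  · exact Realization.ext (C.flow_zero x)
  · rfl
  · rintro t _ ⟨y, rfl⟩
    exact Realization.ext (hflow y t)

end Collapse

end Realization

/-! ### Chains of deformation subcomplexes -/

open Realization

/-- `L` is a subcomplex of `K` whose realization is a strong deformation retract of `|K|`. -/
def IsDeformationSubcomplex {V : Type*} (L K : PreAbstractSimplicialComplex V) : Prop :=
  ∃ h : L ≤ K, IsStrongDeformationRetract (incl h)

theorem IsDeformationSubcomplex.refl {V : Type*} (K : PreAbstractSimplicialComplex V) :
    IsDeformationSubcomplex K K :=
  ⟨le_rfl, isStrongDeformationRetract_id _⟩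

theorem IsDeformationSubcomplex.trans {V : Type*} {A B K : PreAbstractSimplicialComplex V}
    (h₁ : IsDeformationSubcomplex A B) (h₂ : IsDeformationSubcomplex B K) :
    IsDeformationSubcomplex A K := by
  obtain ⟨h, hA⟩ := h₁
  obtain ⟨h', hB⟩ := h₂
  exact ⟨h.trans h', hB.comp hA⟩

/-! ### Counting jumps -/

section Jumps

variable {k : ℕ}

theorem mk_mem_fullSimplex {m : ℕ} {i : ℕ → ZMod k} {a : ZMod k} {p : ℕ} :
    (a, p) ∈ fullSimplex m i ↔ p < m ∧ i p = a := by
  simp only [fullSimplex, mem_image, mem_range, Prod.mk.injEq]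
  constructor
  · rintro ⟨q, hq, h, rfl⟩
    exact ⟨hq, h⟩
  · rintro ⟨hp, h⟩
    exact ⟨p, hp, h, rfl⟩

theorem numJumps_le_pred (m : ℕ) (i : ℕ → ZMod k) : numJumps m i ≤ m - 1 := by
  rw [← card_range (m - 1)]
  refine card_le_card fun j hj => ?_
  have := (mem_filter.1 hj).2.1
  rw [mem_range]
  omega

theorem numJumps_mono {m n : ℕ} (h : m ≤ n) (i : ℕ → ZMod k) : numJumps m i ≤ numJumps n i := by
  refine card_le_card fun j hj => ?_
  simp only [mem_filter, mem_range] at hj ⊢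
  exact ⟨by omega, by omega, hj.2.2⟩

/-- Repeating the last sign in the new copy creates no jump. -/
theorem numJumps_extend (m : ℕ) (i : ℕ → ZMod k) :
    numJumps (m + 1) (fun p => i (min p (m - 1))) ≤ numJumps m i := by
  refine card_le_card fun j hj => ?_
  simp only [mem_filter, mem_range] at hj ⊢
  obtain ⟨-, h1, h2⟩ := hj
  by_cases hj : j + 1 < m
  · rw [min_eq_left (by omega), min_eq_left (by omega)] at h2
    exact ⟨by omega, hj, h2⟩
  · rw [min_eq_right (by omega), min_eq_right (by omega)] at h2
    exact absurd rfl h2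

theorem numJumps_update_le {n j : ℕ} (hj : j + 1 < n) (i : ℕ → ZMod k) :
    numJumps n (Function.update i j (i (j + 1))) ≤ numJumps n i := by
  -- The only possible new jump is at `j - 1`, when `i (j - 1) = i j ≠ i (j + 1)`. It is charged to
  -- the old jump at `j`, which the update removes.
  refine card_le_card_of_injOn (fun p => if p + 1 = j ∧ i p = i j then j else p) ?_ ?_
  · intro p hp
    simp only [coe_filter, mem_range, Set.mem_ofPred_eq, Function.update_apply] at hp ⊢
    grind
  · intro p hp q hq hpq
    simp only [coe_filter, mem_range, Set.mem_ofPred_eq, Function.update_apply] at hp hq hpq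
    grind

end Jumps

/-! ### The filtration by jumping tails and its collapses -/

section Tail

variable {k d m : ℕ}

/-- The set `s` of vertices contains a sequence of vertices in the copies `j, …, m` any two
consecutive ones of which have different signs. -/
def HasJumpingTail (m j : ℕ) (s : Finset (ZMod k × ℕ)) : Prop :=
  ∃ i : ℕ → ZMod k, (∀ p, j ≤ p → p ≤ m → (i p, p) ∈ s) ∧ ∀ p, j ≤ p → p < m → i p ≠ i (p + 1)

theorem HasJumpingTail.mono {j : ℕ} {s t : Finset (ZMod k × ℕ)} (h : HasJumpingTail m j s)
    (hst : s ⊆ t) : HasJumpingTail m j t := by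
  obtain ⟨i, hi, hi'⟩ := h
  exact ⟨i, fun p h1 h2 => hst (hi p h1 h2), hi'⟩

theorem HasJumpingTail.anti {j : ℕ} {s : Finset (ZMod k × ℕ)} (h : HasJumpingTail m j s) :
    HasJumpingTail m (j + 1) s := by
  obtain ⟨i, hi, hi'⟩ := h
  exact ⟨i, fun p h1 => hi p (by omega), fun p h1 => hi' p (by omega)⟩

/-- The subcomplex of `(ℤ_k)^{*(m+1)}_{alt ≤ d}` of the simplices that do not jump all the time
from the copy `j` to the last copy `m`. -/
def tailComplex (k d m j : ℕ) : PreAbstractSimplicialComplex (ZMod k × ℕ) where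
  faces := {s | s ∈ (altComplex k d (m + 1)).faces ∧ ¬ HasJumpingTail m j s}
  isRelLowerSet_faces := fun _ hs => ⟨hs.1.1, fun _ hts ht =>
    ⟨((altComplex k d (m + 1)).isRelLowerSet_faces hs.1).2 hts ht, fun h => hs.2 (h.mono hts)⟩⟩

theorem tailComplex_succ_le (j : ℕ) : tailComplex k d m (j + 1) ≤ tailComplex k d m j :=
  fun _ hs => ⟨hs.1, fun h => hs.2 h.anti⟩

theorem tailComplex_zero (hm : d + 1 ≤ m) : tailComplex k d m 0 = altComplex k d (m + 1) := by
  refine PreAbstractSimplicialComplex.ext (Set.ext fun s => ⟨fun hs => hs.1, fun hs => ⟨hs, ?_⟩⟩)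
  rintro ⟨i', h1, h2⟩
  obtain ⟨-, i, hi, hsi⟩ := hs
  have hii : ∀ p ≤ m, i p = i' p := fun p hp => (mk_mem_fullSimplex.1 (hsi (h1 p p.zero_le hp))).2
  have : #(range m) ≤ numJumps (m + 1) i := by
    refine card_le_card fun j hj => ?_
    simp only [mem_filter, mem_range] at hj ⊢
    refine ⟨by omega, by omega, ?_⟩
    rw [hii j (by omega), hii (j + 1) (by omega)]
    exact h2 j j.zero_le hj
  rw [card_range] at this
  omega

theorem altComplex_le_succ (hm : 1 ≤ m) : altComplex k d m ≤ altComplex k d (m + 1) := by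
  rintro s ⟨hne, i, hi, hsi⟩
  refine ⟨hne, _, (numJumps_extend m i).trans hi, ?_⟩
  rintro ⟨a, p⟩ hp
  obtain ⟨hpm, rfl⟩ := mk_mem_fullSimplex.1 (hsi hp)
  exact mk_mem_fullSimplex.2 ⟨by omega, by rw [min_eq_left (by omega)]⟩

theorem tailComplex_self (hm : 1 ≤ m) : tailComplex k d m m = altComplex k d m := by
  refine PreAbstractSimplicialComplex.ext (Set.ext fun s => ⟨?_, fun hs =>
    ⟨altComplex_le_succ hm hs, ?_⟩⟩)
  · rintro ⟨⟨hne, i, hi, hsi⟩, hs⟩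
    refine ⟨hne, i, (numJumps_mono m.le_succ i).trans hi, ?_⟩
    rintro ⟨a, p⟩ hp
    obtain ⟨hpm, rfl⟩ := mk_mem_fullSimplex.1 (hsi hp)
    refine mk_mem_fullSimplex.2 ⟨lt_of_le_of_ne (by omega) ?_, rfl⟩
    rintro rfl
    -- For `j = m` the jump condition is empty: a single vertex in copy `m` is already a tail.
    refine hs ⟨i, fun q h1 h2 => ?_, fun q h1 h2 => absurd h2 (by omega)⟩
    obtain rfl : q = p := le_antisymm h2 h1
    exact hp
  · rintro ⟨i', h1, -⟩
    obtain ⟨-, i, -, hsi⟩ := hs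
    exact lt_irrefl _ (mk_mem_fullSimplex.1 (hsi (h1 m le_rfl le_rfl))).1

/-- A simplex that jumps all the time from the copy `j + 1` on but not from the copy `j` on lies in
a full simplex with at most `d` jumps that does not jump from the copy `j` to the next one. -/
theorem exists_full_of_notMem {j : ℕ} (hj : j < m) {s : Finset (ZMod k × ℕ)}
    (hs : s ∈ (tailComplex k d m j).faces) (hs' : s ∉ (tailComplex k d m (j + 1)).faces) :
    ∃ i : ℕ → ZMod k, numJumps (m + 1) i ≤ d ∧ s ⊆ fullSimplex (m + 1) i ∧
      (∀ p, j < p → p ≤ m → (i p, p) ∈ s) ∧ (∀ p, j < p → p < m → i p ≠ i (p + 1)) ∧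
      i j = i (j + 1) := by
  have hT : HasJumpingTail m (j + 1) s := by
    by_contra h
    exact hs' ⟨hs.1, h⟩
  obtain ⟨⟨-, i, hi, hsi⟩, hnT⟩ := hs
  obtain ⟨i', h1, h2⟩ := hT
  have hii : ∀ p, j < p → p ≤ m → i' p = i p := fun p hp hp' =>
    (mk_mem_fullSimplex.1 (hsi (h1 p hp hp'))).2.symm
  have h1' : ∀ p, j < p → p ≤ m → (i p, p) ∈ s := fun p hp hp' => hii p hp hp' ▸ h1 p hp hp'
  have h2' : ∀ p, j < p → p < m → i p ≠ i (p + 1) := fun p hp hp' => by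
    rw [← hii p hp hp'.le, ← hii (p + 1) (by omega) hp']
    exact h2 p hp hp'
  by_cases hij : i j = i (j + 1)
  · exact ⟨i, hi, hsi, h1', h2', hij⟩
  -- A vertex of `s` in copy `j` would prolong the tail to `j`. So copy `j` is unused, and `i j` may
  -- be replaced by `i (j + 1)`.
  · have hjs : (i j, j) ∉ s := fun hjs => hnT ⟨i, fun p hp hp' => by
        rcases hp.eq_or_lt with rfl | hp
        exacts [hjs, h1' p hp hp'], fun p hp hp' => by
        rcases hp.eq_or_lt with rfl | hp
        exacts [hij, h2' p hp hp']⟩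
    have hu : ∀ p, p ≠ j → Function.update i j (i (j + 1)) p = i p := fun p hp =>
      Function.update_of_ne hp _ _
    refine ⟨Function.update i j (i (j + 1)), (numJumps_update_le (by omega) i).trans hi, ?_,
      fun p hp hp' => ?_, fun p hp hp' => ?_, ?_⟩
    · rintro ⟨a, p⟩ hp
      obtain ⟨hpm, rfl⟩ := mk_mem_fullSimplex.1 (hsi hp)
      refine mk_mem_fullSimplex.2 ⟨hpm, hu p ?_⟩
      rintro rfl
      exact hjs hp
    · rw [hu p hp.ne']
      exact h1' p hp hp'
    · rw [hu p hp.ne', hu (p + 1) (by omega)]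
      exact h2' p hp hp'
    · rw [Function.update_self, hu (j + 1) (by omega)]

open Classical in
/-- The sign of a vertex of `s` in the copy `j`. -/
noncomputable def signAt (s : Finset (ZMod k × ℕ)) (j : ℕ) : ZMod k :=
  if h : ∃ a, (a, j) ∈ s then h.choose else 0

theorem signAt_eq {s : Finset (ZMod k × ℕ)} {n j : ℕ} {i : ℕ → ZMod k}
    (hs : s ⊆ fullSimplex n i) (hj : (i j, j) ∈ s) : signAt s j = i j := by
  have h : ∃ a, (a, j) ∈ s := ⟨_, hj⟩
  rw [signAt, dif_pos h]
  exact (mk_mem_fullSimplex.1 (hs h.choose_spec)).2.symm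

/-- The face `t` already has a vertex in every copy after `j`, and `s` has at most one in each, so
nothing is left by which the two could differ there. -/
theorem eq_of_subset_of_notMem {j : ℕ} (hj : j < m) {s t : Finset (ZMod k × ℕ)}
    (hs : s ∈ (tailComplex k d m j).faces) (ht : t ∈ (tailComplex k d m j).faces)
    (ht' : t ∉ (tailComplex k d m (j + 1)).faces) (hts : t ⊆ s) :
    t.filter (j < ·.2) = s.filter (j < ·.2) ∧ signAt t (j + 1) = signAt s (j + 1) := by
  have hs' : s ∉ (tailComplex k d m (j + 1)).faces := fun h =>
    ht' (((tailComplex k d m (j + 1)).isRelLowerSet_faces h).2 hts ht.1.1)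
  obtain ⟨i, -, hsi, h1, -⟩ := exists_full_of_notMem hj hs hs'
  obtain ⟨i', -, -, h1', -⟩ := exists_full_of_notMem hj ht ht'
  have hit : ∀ p, j < p → p ≤ m → (i p, p) ∈ t := fun p hp hp' => by
    rw [(mk_mem_fullSimplex.1 (hsi (hts (h1' p hp hp')))).2]
    exact h1' p hp hp'
  refine ⟨(filter_subset_filter _ hts).antisymm ?_, ?_⟩
  · rintro ⟨a, p⟩ hp
    obtain ⟨hps, hjp⟩ := mem_filter.1 hp
    obtain ⟨hpm, rfl⟩ := mk_mem_fullSimplex.1 (hsi hps)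
    exact mem_filter.2 ⟨hit p hjp (by omega), hjp⟩
  · rw [signAt_eq (hts.trans hsi) (hit (j + 1) (by omega) hj),
      signAt_eq hsi (h1 (j + 1) (by omega) hj)]

/-- The simplices that jump all the time from the copy `j + 1` on can be removed by pushing in from
their part in the copies after `j`. -/
noncomputable def tailCollapse (k d : ℕ) {m j : ℕ} (hj : j < m) :
    Collapse (tailComplex k d m j) (tailComplex k d m (j + 1)) where
  τ s := s.filter (j < ·.2)
  v s := (signAt s (j + 1), j)
  nonempty s hs hs' := by
    obtain ⟨i, -, -, h1, -⟩ := exists_full_of_notMem hj hs hs'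
    exact ⟨_, mem_filter.2 ⟨h1 m hj le_rfl, hj⟩⟩
  subset s _ _ := filter_subset _ _
  v_notMem s _ _ h := lt_irrefl _ (mem_filter.1 h).2
  notMem s hs hs' h := by
    obtain ⟨i, -, -, h1, h2, -⟩ := exists_full_of_notMem hj hs hs'
    exact h.2 ⟨i, fun p hp hp' => mem_filter.2 ⟨h1 p hp hp', hp⟩, h2⟩
  insert_mem s hs hs' := by
    obtain ⟨i, hi, hsi, h1, h2, hij⟩ := exists_full_of_notMem hj hs hs'
    rw [signAt_eq hsi (h1 (j + 1) (by omega) hj)]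
    have hsub : insert (i (j + 1), j) s ⊆ fullSimplex (m + 1) i :=
      insert_subset (mk_mem_fullSimplex.2 ⟨by omega, hij⟩) hsi
    refine ⟨⟨insert_nonempty _ _, i, hi, hsub⟩, ?_⟩
    rintro ⟨i', h1', h2'⟩
    have hii : ∀ p, j ≤ p → p ≤ m → i p = i' p := fun p hp hp' =>
      (mk_mem_fullSimplex.1 (hsub (h1' p hp hp'))).2
    -- The added vertex repeats the sign of copy `j + 1`, so no tail can jump at `j`.
    refine h2' j le_rfl hj ?_
    rw [← hii j le_rfl hj.le, ← hii (j + 1) (by omega) hj, hij]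
  erase_mem s hs hs' := by
    rintro ⟨a, p⟩ ha
    obtain ⟨i, hi, hsi, h1, h2, hij⟩ := exists_full_of_notMem hj hs hs'
    obtain ⟨has, hjp⟩ := mem_filter.1 ha
    obtain ⟨hpm, rfl⟩ := mk_mem_fullSimplex.1 (hsi has)
    rw [signAt_eq hsi (h1 (j + 1) (by omega) hj)]
    have hsub : insert (i (j + 1), j) s ⊆ fullSimplex (m + 1) i :=
      insert_subset (mk_mem_fullSimplex.2 ⟨by omega, hij⟩) hsi
    refine ⟨⟨⟨(i (j + 1), j), mem_erase.2 ⟨fun h => ?_, mem_insert_self _ _⟩⟩, i, hi,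
      (erase_subset _ _).trans hsub⟩, ?_⟩
    · exact hjp.ne (Prod.ext_iff.1 h).2
    -- Erasing the only vertex in copy `p > j` interrupts every tail starting at `j + 1`.
    · rintro ⟨i', h1', -⟩
      have h := mem_erase.1 (h1' p hjp (by omega))
      exact h.1 (by rw [(mk_mem_fullSimplex.1 (hsub h.2)).2])
  τ_eq s hs t ht ht' hts := (eq_of_subset_of_notMem hj hs ht ht' hts).1
  v_eq s hs t ht ht' hts := by rw [(eq_of_subset_of_notMem hj hs ht ht' hts).2]

/-! ### Assembling the chain -/

theorem isDeformationSubcomplex_succ (k : ℕ) (hm : d + 1 ≤ m) :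
    IsDeformationSubcomplex (altComplex k d m) (altComplex k d (m + 1)) := by
  have h : ∀ j ≤ m, IsDeformationSubcomplex (tailComplex k d m j) (tailComplex k d m 0) := by
    intro j
    induction j with
    | zero => exact fun _ => .refl _
    | succ j ih =>
      exact fun hj => .trans ⟨tailComplex_succ_le j,
        (tailCollapse k d hj).isStrongDeformationRetract _⟩ (ih (by omega))
  have := h m le_rfl
  rwa [tailComplex_zero hm, tailComplex_self (by omega)] at this

theorem isDeformationSubcomplex_of_le (k : ℕ) {m n : ℕ} (hm : d + 1 ≤ m) (hmn : m ≤ n) :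
    IsDeformationSubcomplex (altComplex k d m) (altComplex k d n) := by
  induction n, hmn using Nat.le_induction with
  | base => exact .refl _
  | succ n hn ih => exact ih.trans (isDeformationSubcomplex_succ k (hm.trans hn))

theorem isDeformationSubcomplex_union (k : ℕ) {m : ℕ} (hm : d + 1 ≤ m) :
    IsDeformationSubcomplex (altComplex k d m) (altComplexUnion k d) := by
  have hK : ∀ n, altComplex k d (m + n) ≤ altComplex k d (m + (n + 1)) := fun n =>
    altComplex_le_succ (by omega)
  have hU : ∀ n, altComplex k d (m + n) ≤ altComplexUnion k d := fun n s hs =>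
    Set.mem_iUnion₂.2 ⟨m + n, by omega, hs⟩
  refine ⟨hU 0, isStrongDeformationRetract_union (K := fun n => altComplex k d (m + n)) hK hU
    (fun s hs => ?_) fun n => ?_⟩
  · obtain ⟨n, hn, hs⟩ := Set.mem_iUnion₂.1 hs
    -- The cofinal sequence starting at `m` suffices: a face of stage `n` is also a face of stage `m
    -- + n`.
    obtain ⟨h, -⟩ := isDeformationSubcomplex_of_le k hn (Nat.le_add_left n m)
    exact ⟨n, h hs⟩
  · exact (isDeformationSubcomplex_succ k (Nat.le_add_right_of_le hm)).2

/-- With `d + 1` copies there are only `d` places to jump, so the bound is vacuous, and empty copies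
can be filled with any sign (here the default `0` of `signAt`). -/
theorem joinComplex_eq_altComplex (k d : ℕ) :
    joinComplex k (d + 1) = altComplex k d (d + 1) := by
  refine PreAbstractSimplicialComplex.ext (Set.ext fun s => ⟨?_, ?_⟩)
  · rintro ⟨hne, h1, h2⟩
    refine ⟨hne, signAt s, numJumps_le_pred _ _, ?_⟩
    rintro ⟨a, p⟩ hp
    have h : ∃ a, (a, p) ∈ s := ⟨a, hp⟩
    refine mk_mem_fullSimplex.2 ⟨h1 _ hp, ?_⟩
    rw [signAt, dif_pos h]
    exact (Prod.ext_iff.1 (h2 _ h.choose_spec _ hp rfl)).1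
  · rintro ⟨hne, i, -, hsi⟩
    refine ⟨hne, fun v hv => (mk_mem_fullSimplex.1 (hsi hv)).1, ?_⟩
    rintro ⟨a, p⟩ hp ⟨b, q⟩ hq (rfl : p = q)
    rw [← (mk_mem_fullSimplex.1 (hsi hp)).2, ← (mk_mem_fullSimplex.1 (hsi hq)).2]

end Tail

theorem theorem6p1 (k d : ℕ) (hk : 2 ≤ k) :
    -- the first space of the chain
    joinComplex k (d + 1) = altComplex k d (d + 1) ∧
    -- the inclusions between the spaces with finitely many copies
    (∀ m n : ℕ, d + 1 ≤ m → m ≤ n →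
      ∃ h : altComplex k d m ≤ altComplex k d n,
        (∀ (g : ZMod k) (x : Realization (altComplex k d m)),
          Realization.incl h (g +ᵥ x) = g +ᵥ Realization.incl h x) ∧
        IsStrongDeformationRetract (Realization.incl h)) ∧
    -- the inclusions into the union
    (∀ m : ℕ, d + 1 ≤ m →
      ∃ h : altComplex k d m ≤ altComplexUnion k d,
        (∀ (g : ZMod k) (x : Realization (altComplex k d m)),
          Realization.incl h (g +ᵥ x) = g +ᵥ Realization.incl h x) ∧
        IsStrongDeformationRetract (Realization.incl h)) := by
  refine ⟨joinComplex_eq_altComplex k d, fun m n hm hmn => ?_, fun m hm => ?_⟩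
  · obtain ⟨h, hr⟩ := isDeformationSubcomplex_of_le k hm hmn
    exact ⟨h, fun g x => rfl, hr⟩
  · obtain ⟨h, hr⟩ := isDeformationSubcomplex_union k hm
    exact ⟨h, fun g x => rfl, hr⟩
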